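/- Let $G=(V,E)$ be a finite directed acyclic graph. A vertex (neuron) without incoming (resp. outgoing) edges is called an input (resp. output) neuron. Let $B\subseteq V$ be a set of non-input neurons, the neurons that carry a bias (so $B=\emptyset$ is a network without biases and $B=V\setminus V_{\mathrm{in}}$ one with all biases). The parameters of a ReLU network with this architecture (with any mix of ReLU, linear and max-pooling activations) are $\theta=((\theta_{u\to v})_{(u,v)\in E},(\theta_v)_{v\in B})\in\mathbb R^D$, $D=|E|+|B|$. Let $\mathcal P$ be the finite set of directed paths $p=(v_0\to v_1\to\cdots\to v_m)$, $m\ge 0$, with $v_m$ an output neuron and $v_0$ an input neuron or an element of $B$, and let $d=|\mathcal P|$. The path-lifting $\phi=\phi_{\mathtt{ReLU}}:\mathbb R^D\to\mathbb R^{d}$ has the coordinates $\phi_p(\theta)=\prod_{i=1}^m\theta_{v_{i-1}\to v_i}$ if $v_0$ is an input neuron and $\phi_p(\theta)=\theta_{v_0}\prod_{i=1}^m\theta_{v_{i-1}\to v_i}$ if $v_0\in B$ (an empty product is $1$). Write $M(\theta)=\partial\phi(\theta)\,\partial\phi(\theta)^\top\in\mathbb R^{d\times d}$. Conservation laws for $\phi$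 are the components of a map $\mathbf h\in\mathcal C^1(\mathbb R^D,\mathbb R^N)$, $N\geq 0$, with $\partial\phi(\theta)\nabla \mathbf h_i(\theta)=0$ for all $i$ and $\theta$. For an open set $U\ni\theta_0$ one says that, with respect to $\phi$, - $\theta_0$ has the intrinsic recoverability property on $U$ if there are conservation laws $\mathbf h$ for $\phi$ with values in some $\mathbb R^N$ and $\Gamma\in\mathcal C^1(\mathbb R^d\times\mathbb R^N,\mathbb R^D)$ such that $\theta=\Gamma(\phi(\theta),\mathbf h(\theta))$ for all $\theta\in U$; - $\theta_0$ has the intrinsic metric property on $U$ if there are conservation laws $\mathbf h$ for $\phi$ and $K\in\mathcal C^1(\mathbb R^d,\mathbb R^{d\times d})$ such that $M(\theta)=K(\phi(\theta))$ for all $\theta\in U$ with $\mathbf h(\theta)=\mathbf h(\theta_0)$; - $\theta_0$ has the intrinsic dynamic property on $U$ if there is $K:\mathbb R^d\to\mathbb R^{d\times d}$ such that for every $f\in\mathcal C^2(\mathbb R^d,\mathbb R)$ the maximal solution $\theta(\cdot)$ of $\dot\theta(t)=-\nabla(f\circ\phi)(\theta(t))$, $\theta(0)=\theta_0$, satisfies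 $M(\theta(t))=K(\phi(\theta(t)))$ for each $t$ in its interval of existence with $\theta(t)\in U$. Then there is a dense open set $\Theta\subseteq\mathbb R^D$ such that every $\theta_0\in\Theta$ has an open neighbourhood $U\subseteq\Theta$ on which $\theta_0$ has the intrinsic recoverability property, the intrinsic metric property and the intrinsic dynamic property with respect to $\phi_{\mathtt{ReLU}}$. -/

import Mathlib

noncomputable section

namespace IntrinsicFlow

section Properties

variable {ι κ : Type*} [Fintype ι] [Fintype κ] [DecidableEq ι]

/-- The Jacobian matrix `∂φ(θ)` of `φ : ℝ^D → ℝ^d`. -/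
def jacobian (φ : EuclideanSpace ℝ ι → EuclideanSpace ℝ κ) (θ : EuclideanSpace ℝ ι) :
    Matrix κ ι ℝ :=
  Matrix.of fun k i => fderiv ℝ φ θ (EuclideanSpace.single i 1) k

/-- `M(θ) = ∂φ(θ) ∂φ(θ)ᵀ`. -/
def metricMatrix (φ : EuclideanSpace ℝ ι → EuclideanSpace ℝ κ) (θ : EuclideanSpace ℝ ι) :
    Matrix κ κ ℝ :=
  jacobian φ θ * (jacobian φ θ).transpose

/-- `h` is a conservation law for `φ` on `Ω`: it is `C¹` on `Ω` and `∂φ(θ) ∇h(θ) = 0` there. -/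
def IsConservationLaw (φ : EuclideanSpace ℝ ι → EuclideanSpace ℝ κ)
    (Ω : Set (EuclideanSpace ℝ ι)) (h : EuclideanSpace ℝ ι → ℝ) : Prop :=
  ContDiffOn ℝ 1 h Ω ∧ ∀ θ ∈ Ω, fderiv ℝ φ θ (gradient h θ) = 0

/-- A finite family of conservation laws for `φ` on the whole parameter space. -/
def AreConservationLaws {N : ℕ} (φ : EuclideanSpace ℝ ι → EuclideanSpace ℝ κ)
    (h : EuclideanSpace ℝ ι → EuclideanSpace ℝ (Fin N)) : Prop :=
  ∀ i, IsConservationLaw φ Set.univ (fun θ => h θ i)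

/-- Intrinsic recoverability property of `θ₀` on the open set `U ∋ θ₀` with respect to `φ`. -/
def IntrinsicRecoverability (φ : EuclideanSpace ℝ ι → EuclideanSpace ℝ κ)
    (U : Set (EuclideanSpace ℝ ι)) (θ₀ : EuclideanSpace ℝ ι) : Prop :=
  IsOpen U ∧ θ₀ ∈ U ∧
    ∃ (N : ℕ) (h : EuclideanSpace ℝ ι → EuclideanSpace ℝ (Fin N)),
      AreConservationLaws φ h ∧
      ∃ Γ : EuclideanSpace ℝ κ × EuclideanSpace ℝ (Fin N) → EuclideanSpace ℝ ι,
        ContDiff ℝ 1 Γ ∧ ∀ θ ∈ U, θ = Γ (φ θ, h θ)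

/-- Intrinsic metric property of `θ₀` on the open set `U ∋ θ₀` with respect to `φ`;
`K` is `C¹` as a matrix-valued map, that is, entry by entry. -/
def IntrinsicMetric (φ : EuclideanSpace ℝ ι → EuclideanSpace ℝ κ)
    (U : Set (EuclideanSpace ℝ ι)) (θ₀ : EuclideanSpace ℝ ι) : Prop :=
  IsOpen U ∧ θ₀ ∈ U ∧
    ∃ (N : ℕ) (h : EuclideanSpace ℝ ι → EuclideanSpace ℝ (Fin N)),
      AreConservationLaws φ h ∧
      ∃ K : EuclideanSpace ℝ κ → Matrix κ κ ℝ,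
        (∀ k l, ContDiff ℝ 1 fun z => K z k l) ∧
        ∀ θ ∈ {θ | h θ = h θ₀} ∩ U, metricMatrix φ θ = K (φ θ)

/-- `x` solves the gradient flow `ẋ = -∇ℓ(x)`, `x(0) = θ₀`, on the open interval `I ∋ 0`. -/
structure IsGradientFlow (ℓ : EuclideanSpace ℝ ι → ℝ) (θ₀ : EuclideanSpace ℝ ι)
    (I : Set ℝ) (x : ℝ → EuclideanSpace ℝ ι) : Prop where
  isOpen : IsOpen I
  ordConnected : I.OrdConnected
  zero_mem : (0 : ℝ) ∈ I
  initial : x 0 = θ₀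
  hasDerivAt : ∀ t ∈ I, HasDerivAt x (-gradient ℓ (x t)) t

/-- A gradient flow that has no extension to a strictly larger open interval. -/
structure IsMaximalGradientFlow (ℓ : EuclideanSpace ℝ ι → ℝ) (θ₀ : EuclideanSpace ℝ ι)
    (I : Set ℝ) (x : ℝ → EuclideanSpace ℝ ι) : Prop extends IsGradientFlow ℓ θ₀ I x where
  maximal : ∀ (J : Set ℝ) (y : ℝ → EuclideanSpace ℝ ι),
    IsGradientFlow ℓ θ₀ J y → I ⊆ J → Set.EqOn y x I → J = I

/-- Intrinsic dynamic property of `θ₀` on `Ω` with respect to `φ`: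
one `K` serves all `C²` functions `f`. -/
def IntrinsicDynamic (φ : EuclideanSpace ℝ ι → EuclideanSpace ℝ κ)
    (Ω : Set (EuclideanSpace ℝ ι)) (θ₀ : EuclideanSpace ℝ ι) : Prop :=
  ∃ K : EuclideanSpace ℝ κ → Matrix κ κ ℝ,
    ∀ f : EuclideanSpace ℝ κ → ℝ, ContDiff ℝ 2 f →
      ∀ (I : Set ℝ) (x : ℝ → EuclideanSpace ℝ ι),
        IsMaximalGradientFlow (f ∘ φ) θ₀ I x →
          ∀ t ∈ I, x t ∈ Ω → metricMatrix φ (x t) = K (φ (x t))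

end Properties

/-- The architecture of a DAG ReLU network on the set `V` of neurons, as far as its path-lifting
is concerned (the lifting does not depend on which neurons carry a ReLU, linear or max-pooling
activation). Input neurons carry no bias; any set of other neurons may carry one, so that
`biased = ∅` is a network without biases and `biased = {v | v is not an input}` one with
all of them. -/
structure DAGNetwork (V : Type*) where
  graph : Digraph V
  acyclic : ∀ v, ¬ Relation.TransGen graph.Adj v v
  biased : Set V
  biased_not_input : ∀ v ∈ biased, ∃ u, graph.Adj u v

namespace DAGNetwork

variable {V : Type*} (G : DAGNetwork V)

/-- Input neurons: no antecedent. -/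
def IsInput (v : V) : Prop := ∀ u, ¬ G.graph.Adj u v

/-- Output neurons: no successor. -/
def IsOutput (v : V) : Prop := ∀ u, ¬ G.graph.Adj v u

/-- Index set of the parameters: one weight per edge, one bias per biased neuron. -/
abbrev Param : Type _ := {e : V × V // G.graph.Adj e.1 e.2} ⊕ {v : V // v ∈ G.biased}

/-- Index set of the path-lifting: the directed paths `v₀ → ⋯ → v_m`, `m ≥ 0`, that end at an
output neuron and start at an input neuron or at a neuron that carries a bias. -/
@[ext]
structure Path where
  verts : List V
  ne_nil : verts ≠ []
  chain : verts.IsChain G.graph.Adj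
  start : G.IsInput (verts.head ne_nil) ∨ verts.head ne_nil ∈ G.biased
  finish : G.IsOutput (verts.getLast ne_nil)

instance [Finite V] : Finite G.Path := by
  have hnd : ∀ p : G.Path, p.verts.Nodup := by
    intro p
    have h1 : p.verts.IsChain (Relation.TransGen G.graph.Adj) :=
      p.chain.imp fun _ _ h => Relation.TransGen.single h
    have h2 := List.isChain_iff_pairwise.mp h1
    refine h2.imp ?_
    rintro a b hab rfl
    exact G.acyclic _ hab
  classical
  haveI := Fintype.ofFinite V
  exact Finite.of_injective (fun p : G.Path => (⟨p.verts, hnd p⟩ : {l : List V // l.Nodup}))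
    fun p q h => Path.ext (congrArg Subtype.val h)

instance [Finite V] : Fintype G.Path := Fintype.ofFinite _

instance [Finite V] : Fintype G.Param := Fintype.ofFinite _

instance : DecidableEq G.Param := Classical.decEq _

open Classical in
/-- The weight of the edge `u → v` (only evaluated on edges). -/
def weight (θ : EuclideanSpace ℝ G.Param) (u v : V) : ℝ :=
  if h : G.graph.Adj u v then θ (Sum.inl ⟨(u, v), h⟩) else 0

/-- The product of the weights along a list of neurons; an empty product is `1`. -/
def weightProd (θ : EuclideanSpace ℝ G.Param) : List V → ℝ
  | [] => 1
  | [_] => 1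
  | u :: v :: l => G.weight θ u v * weightProd θ (v :: l)

open Classical in
/-- The factor contributed by the first neuron of a path: its bias, or `1` for an input neuron. -/
def startFactor (θ : EuclideanSpace ℝ G.Param) (v : V) : ℝ :=
  if h : v ∈ G.biased then θ (Sum.inr ⟨v, h⟩) else 1

/-- The path-lifting `φ_ReLU : ℝ^D → ℝ^d`. -/
def pathLifting [Finite V] (θ : EuclideanSpace ℝ G.Param) : EuclideanSpace ℝ G.Path :=
  WithLp.toLp 2 fun p => G.startFactor θ (p.verts.head p.ne_nil) * G.weightProd θ p.verts

end DAGNetwork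

end IntrinsicFlow

end

noncomputable section

namespace IntrinsicFlow

open Set Filter Topology

/-! Let all parameters be nonzero and write a tangent vector as `δ i = x i * θ i`. The path-lifting
is monomial, so its derivative along `δ` multiplies each (nonzero) path coordinate by the sum of the
labels `x` along the path (`fderiv_pathLifting_rescale`). The kernel thus consists of labels with
zero path sums, that is, of differences of potentials `c` vanishing at inputs and outputs
(`exists_potential`): the infinitesimal neuronwise rescalings. Each such field is half the gradient
of `balance c`, so `balance c` is a conservation law and these gradients fill the kernel. A kernel
vector orthogonal to all of them is zero; hence the lifting together with the finitely many
hidden-neuron balances is an immersion.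

A local left inverse `Γ` gives recoverability. On a level set of the laws, `M(θ)` is `M` at `Γ (φ θ,
h θ₀)`, a function of `φ θ`; gradient flows stay on that level set
(`exists_intrinsic_of_immersion`). -/

/-- A map that is `C¹` near `x₀` with injective derivative there has a local left inverse which is
`C¹` on the whole target space. -/
theorem exists_contDiff_local_leftInverse {E F : Type*}
    [NormedAddCommGroup E] [NormedSpace ℝ E] [FiniteDimensional ℝ E]
    [NormedAddCommGroup F] [NormedSpace ℝ F] [FiniteDimensional ℝ F]
    {Ψ : E → F} {x₀ : E} (hΨ : ContDiffAt ℝ 1 Ψ x₀)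
    (hinj : Function.Injective (fderiv ℝ Ψ x₀)) :
    ∃ Γ : F → E, ContDiff ℝ 1 Γ ∧ ∀ᶠ x in 𝓝 x₀, Γ (Ψ x) = x := by
  have : CompleteSpace E := FiniteDimensional.complete ℝ E
  -- Composing with a linear left inverse of the derivative reduces to the inverse function theorem
  -- at derivative `id`.
  obtain ⟨L₀, hL₀⟩ := LinearMap.exists_leftInverse_of_injective
    (fderiv ℝ Ψ x₀ : E →ₗ[ℝ] F) (LinearMap.ker_eq_bot.mpr hinj)
  set L : F →L[ℝ] E := LinearMap.toContinuousLinearMap L₀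
  have hLD : L.comp (fderiv ℝ Ψ x₀) = ContinuousLinearMap.id ℝ E := by
    ext v
    exact LinearMap.congr_fun hL₀ v
  have hf : ContDiffAt ℝ 1 (fun x => L (Ψ x)) x₀ := L.contDiff.contDiffAt.comp x₀ hΨ
  have hf' : HasFDerivAt (fun x => L (Ψ x))
      ((ContinuousLinearEquiv.refl ℝ E : E ≃L[ℝ] E) : E →L[ℝ] E) x₀ := by
    have := L.hasFDerivAt.comp x₀ (hΨ.differentiableAt one_ne_zero).hasFDerivAt
    rw [hLD] at this
    exact this
  set g : E → E := hf.localInverse hf' one_ne_zero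
  have hgc : ContDiffAt ℝ 1 g (L (Ψ x₀)) := hf.to_localInverse hf' one_ne_zero
  have hgl : ∀ᶠ x in 𝓝 x₀, g (L (Ψ x)) = x :=
    (hf.hasStrictFDerivAt' hf' one_ne_zero).eventually_left_inverse
  obtain ⟨r, hr, hball⟩ := Metric.eventually_nhds_iff_ball.mp (hgc.eventually (by simp))
  -- `g` is known to be `C¹` only on the ball of radius `r`; the cutoff, supported in radius `r /
  -- 2`, makes it global without changing it near the centre.
  let χ : ContDiffBump (L (Ψ x₀)) := ⟨r / 4, r / 2, by positivity, by linarith⟩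
  have hG : ContDiff ℝ 1 (fun y => χ y • g y) := by
    rw [contDiff_iff_contDiffAt]
    intro y
    by_cases hy : y ∈ Metric.ball (L (Ψ x₀)) r
    · exact χ.contDiffAt.smul (hball y hy)
    · have hy' : y ∉ tsupport χ := by
        rw [χ.tsupport_eq, Metric.mem_closedBall]
        rw [Metric.mem_ball] at hy
        change ¬ _ ≤ r / 2
        linarith
      have h0 : (fun y => χ y • g y) =ᶠ[𝓝 y] fun _ => 0 := by
        filter_upwards [notMem_tsupport_iff_eventuallyEq.mp hy'] with z hz
        rw [hz]
        simp
      exact contDiffAt_const.congr_of_eventuallyEq h0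
  refine ⟨fun z => χ (L z) • g (L z), hG.comp L.contDiff, ?_⟩
  filter_upwards [hgl, hf.continuousAt.eventually χ.eventuallyEq_one] with x hx hx'
  simp only [Pi.one_apply] at hx'
  rw [hx', hx, one_smul]

theorem dense_forall_ne_zero {ι : Type*} : Dense {θ : EuclideanSpace ℝ ι | ∀ i, θ i ≠ 0} := by
  have h : Dense (Set.pi univ fun _ : ι => ({0}ᶜ : Set ℝ)) :=
    dense_pi univ fun i _ => dense_compl_singleton 0
  have := h.preimage (EuclideanSpace.equiv ι ℝ).toHomeomorph.isOpenMap
  convert this using 1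
  ext θ
  simp

/-! ### From an immersion to the intrinsic properties -/

section Properties

variable {ι κ : Type*} [Fintype ι] [Fintype κ]

theorem contDiff_metricMatrix [DecidableEq ι] {φ : EuclideanSpace ℝ ι → EuclideanSpace ℝ κ}
    (hφ : ContDiff ℝ 2 φ) (k l : κ) : ContDiff ℝ 1 fun θ => metricMatrix φ θ k l := by
  have hj : ∀ k i, ContDiff ℝ 1 fun θ => jacobian φ θ k i := by
    intro k i
    have h1 : ContDiff ℝ 1 (fderiv ℝ φ) := hφ.fderiv_right (by norm_num)
    have h2 : ContDiff ℝ 1 fun θ => fderiv ℝ φ θ (EuclideanSpace.single i 1) :=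
      h1.clm_apply contDiff_const
    exact contDiff_euclidean.mp h2 k
  simp only [metricMatrix, Matrix.mul_apply, Matrix.transpose_apply]
  exact ContDiff.sum fun i _ => (hj k i).mul (hj l i)

theorem inner_gradient_apply (h : EuclideanSpace ℝ ι → ℝ) (θ δ : EuclideanSpace ℝ ι) :
    inner ℝ (gradient h θ) δ = fderiv ℝ h θ δ := by
  rw [gradient, InnerProductSpace.toDual_symm_apply]

/-- A conservation law is constant along the gradient flow of every loss that factors
through `φ`. -/
theorem IsConservationLaw.eq_of_isGradientFlow {φ : EuclideanSpace ℝ ι → EuclideanSpace ℝ κ}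
    (hφ : Differentiable ℝ φ) {h : EuclideanSpace ℝ ι → ℝ} (hh : IsConservationLaw φ univ h)
    {f : EuclideanSpace ℝ κ → ℝ} (hf : Differentiable ℝ f) {θ₀ : EuclideanSpace ℝ ι} {I : Set ℝ}
    {x : ℝ → EuclideanSpace ℝ ι} (hx : IsGradientFlow (f ∘ φ) θ₀ I x) {t : ℝ} (ht : t ∈ I) :
    h (x t) = h θ₀ := by
  have hhd : Differentiable ℝ h := (contDiffOn_univ.mp hh.1).differentiable one_ne_zero
  have hzero : ∀ s ∈ I, HasDerivAt (fun s => h (x s)) 0 s := by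
    intro s hs
    have h1 := (hhd (x s)).hasFDerivAt.comp_hasDerivAt s (hx.hasDerivAt s hs)
    have h2 : fderiv ℝ h (x s) (-gradient (f ∘ φ) (x s)) = 0 := by
      -- By symmetry of the inner product, the derivative of `f ∘ φ` acts on `∇h`, which `∂φ`
      -- already kills.
      rw [map_neg, ← inner_gradient_apply, real_inner_comm, inner_gradient_apply, fderiv_comp (x s) (hf _) (hφ _),
        ContinuousLinearMap.comp_apply, hh.2 _ (mem_univ _), map_zero, neg_zero]
    rwa [h2] at h1
  have hconv : Convex ℝ I := hx.ordConnected.convex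
  have := hconv.is_const_of_fderivWithin_eq_zero (𝕜 := ℝ) (f := fun s => h (x s))
    (fun s hs => (hzero s hs).differentiableAt.differentiableWithinAt)
    (fun s hs => by
      rw [fderivWithin_of_isOpen hx.isOpen hs]
      ext
      simpa using (hzero s hs).deriv)
    ht hx.zero_mem
  simpa [hx.initial] using this

/-- If `φ` together with finitely many conservation laws is an immersion at `θ₀`, then `θ₀` has all
three intrinsic properties on some neighbourhood inside any given open set `Θ ∋ θ₀`. -/
theorem exists_intrinsic_of_immersion [DecidableEq ι]
    {φ : EuclideanSpace ℝ ι → EuclideanSpace ℝ κ}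
    (hφ : ContDiff ℝ 2 φ) {N : ℕ} {h : EuclideanSpace ℝ ι → EuclideanSpace ℝ (Fin N)}
    (hh : AreConservationLaws φ h) {θ₀ : EuclideanSpace ℝ ι}
    (hinj : ∀ δ, fderiv ℝ φ θ₀ δ = 0 → fderiv ℝ h θ₀ δ = 0 → δ = 0)
    {Θ : Set (EuclideanSpace ℝ ι)} (hΘ : IsOpen Θ) (hθ₀ : θ₀ ∈ Θ) :
    ∃ U : Set (EuclideanSpace ℝ ι), IsOpen U ∧ θ₀ ∈ U ∧ U ⊆ Θ ∧
      IntrinsicRecoverability φ U θ₀ ∧ IntrinsicMetric φ U θ₀ ∧ IntrinsicDynamic φ U θ₀ := by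
  have hhc : ContDiff ℝ 1 h := contDiff_euclidean.mpr fun i => contDiffOn_univ.mp (hh i).1
  have hφ1 : ContDiff ℝ 1 φ := hφ.of_le (by norm_num)
  have hφd : Differentiable ℝ φ := hφ1.differentiable one_ne_zero
  have hΨ : ContDiff ℝ 1 fun θ => (φ θ, h θ) := hφ1.prodMk hhc
  have hΨ' : Function.Injective (fderiv ℝ (fun θ => (φ θ, h θ)) θ₀) := by
    rw [DifferentiableAt.fderiv_prodMk (hφd θ₀) (hhc.differentiable one_ne_zero θ₀),
      injective_iff_map_eq_zero]
    intro δ hδ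
    rw [ContinuousLinearMap.prod_apply, Prod.mk_eq_zero] at hδ
    exact hinj δ hδ.1 hδ.2
  obtain ⟨Γ, hΓ, hleft⟩ := exists_contDiff_local_leftInverse hΨ.contDiffAt hΨ'
  obtain ⟨U, hU, hUo, hθU⟩ := eventually_nhds_iff.mp (hleft.and (hΘ.mem_nhds hθ₀))
  have hK : ∀ θ ∈ {θ | h θ = h θ₀} ∩ U,
      metricMatrix φ θ = metricMatrix φ (Γ (φ θ, h θ₀)) := by
    rintro θ ⟨hθ, hθ'⟩
    rw [← show h θ = h θ₀ from hθ, (hU θ hθ').1]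
  refine ⟨U, hUo, hθU, fun θ hθ => (hU θ hθ).2,
    ⟨hUo, hθU, N, h, hh, Γ, hΓ, fun θ hθ => (hU θ hθ).1.symm⟩,
    ⟨hUo, hθU, N, h, hh, fun z => metricMatrix φ (Γ (z, h θ₀)), fun k l => ?_, hK⟩,
    ⟨fun z => metricMatrix φ (Γ (z, h θ₀)), fun f hf I x hx t ht hxt => hK _ ⟨?_, hxt⟩⟩⟩
  · exact (contDiff_metricMatrix hφ k l).comp
      (hΓ.comp (contDiff_id.prodMk contDiff_const))
  -- Conservation holds on all of `I`, so it does not matter whether the flow leaves `U` and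
  -- returns.
  · ext i
    exact (hh i).eq_of_isGradientFlow hφd (hf.differentiable two_ne_zero)
      hx.toIsGradientFlow ht

/-- The gradient of a diagonal quadratic form. -/
theorem hasGradientAt_sum_mul_sq (a : ι → ℝ) (θ : EuclideanSpace ℝ ι) :
    HasGradientAt (fun θ : EuclideanSpace ℝ ι => ∑ i, a i * θ i ^ 2)
      (WithLp.toLp 2 fun i => 2 * (a i * θ i)) θ := by
  rw [hasGradientAt_iff_hasFDerivAt]
  have h : HasFDerivAt (fun θ : EuclideanSpace ℝ ι => ∑ i, a i * θ i ^ 2)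
      (∑ i, a i • ((2 * θ i) • (EuclideanSpace.proj i : EuclideanSpace ℝ ι →L[ℝ] ℝ))) θ := by
    refine HasFDerivAt.fun_sum fun i _ => HasFDerivAt.const_mul ?_ (a i)
    have := (EuclideanSpace.proj i : EuclideanSpace ℝ ι →L[ℝ] ℝ).hasFDerivAt (x := θ) |>.pow 2
    simpa using this
  refine h.congr_fderiv ?_
  ext δ
  rw [InnerProductSpace.toDual_apply_apply, PiLp.inner_apply, sum_apply]
  refine Finset.sum_congr rfl fun i _ => ?_
  simp
  ring

theorem isOpen_forall_ne_zero : IsOpen {θ : EuclideanSpace ℝ ι | ∀ i, θ i ≠ 0} := by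
  simp only [Set.ofPred_forall]
  exact isOpen_iInter_of_finite fun i =>
    isOpen_ne_fun (EuclideanSpace.proj i : EuclideanSpace ℝ ι →L[ℝ] ℝ).continuous
      continuous_const

end Properties

/-! ### Path sums and potentials -/

namespace DAGNetwork

variable {V : Type*} (G : DAGNetwork V)

/-- The sum of the edge labels along a list of neurons. -/
def edgeSum (x : EuclideanSpace ℝ G.Param) : List V → ℝ
  | [] => 0
  | [_] => 0
  | u :: v :: l => G.weight x u v + edgeSum x (v :: l)

open Classical in
/-- The bias label of a neuron, `0` if it carries none. -/
def biasLabel (x : EuclideanSpace ℝ G.Param) (v : V) : ℝ :=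
  if h : v ∈ G.biased then x (Sum.inr ⟨v, h⟩) else 0

/-- Coordinatewise multiplication of parameters. -/
def rescale (x θ : EuclideanSpace ℝ G.Param) : EuclideanSpace ℝ G.Param :=
  WithLp.toLp 2 fun i => x i * θ i

/-- The parameter labels `c v - c u` on edges and `c v` on biases, for a potential `c`. -/
def potentialLabel (c : V → ℝ) : EuclideanSpace ℝ G.Param :=
  WithLp.toLp 2 fun i => match i with
    | Sum.inl e => c e.1.2 - c e.1.1
    | Sum.inr v => c v.1

variable {G}

/-- Acyclicity makes the transitive closure a strict order on a finite set, which allows induction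
from the inputs and, with the order reversed, from the outputs. -/
theorem wellFounded_adj [Finite V] : WellFounded G.graph.Adj := by
  have : Std.Irrefl (Relation.TransGen G.graph.Adj) := ⟨G.acyclic⟩
  exact WellFounded.mono (Finite.wellFounded_of_trans_of_irrefl (Relation.TransGen G.graph.Adj))
    fun _ _ h => Relation.TransGen.single h

theorem wellFounded_flip_adj [Finite V] : WellFounded (flip G.graph.Adj) := by
  have : Std.Irrefl (flip (Relation.TransGen G.graph.Adj)) := ⟨G.acyclic⟩
  have : IsTrans V (flip (Relation.TransGen G.graph.Adj)) := ⟨fun _ _ _ h h' => h'.trans h⟩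
  exact WellFounded.mono
    (Finite.wellFounded_of_trans_of_irrefl (flip (Relation.TransGen G.graph.Adj)))
    fun _ _ h => Relation.TransGen.single h

theorem exists_chain_to_output [Finite V] (v : V) :
    ∃ l : List V, (v :: l).IsChain G.graph.Adj ∧
      G.IsOutput ((v :: l).getLast (List.cons_ne_nil v l)) := by
  induction v using wellFounded_flip_adj (G := G).induction with
  | _ v ih =>
    by_cases hv : G.IsOutput v
    · exact ⟨[], List.isChain_singleton v, hv⟩
    · simp only [IsOutput, not_forall, not_not] at hv
      obtain ⟨u, hu⟩ := hv
      obtain ⟨l, hl, hlast⟩ := ih u hu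
      refine ⟨u :: l, List.isChain_cons_cons.mpr ⟨hu, hl⟩, ?_⟩
      rwa [List.getLast_cons (List.cons_ne_nil u l)]

theorem edgeSum_potentialLabel (c : V → ℝ) (v : V) (l : List V)
    (hl : (v :: l).IsChain G.graph.Adj) :
    G.edgeSum (G.potentialLabel c) (v :: l)
      = c ((v :: l).getLast (List.cons_ne_nil v l)) - c v := by
  induction l generalizing v with
  | nil => simp [edgeSum]
  | cons u l ih =>
    obtain ⟨hu, hl⟩ := List.isChain_cons_cons.mp hl
    rw [edgeSum, ih u hl, List.getLast_cons (List.cons_ne_nil u l), weight, dif_pos hu]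
    simp [potentialLabel]

/-- The edge labels telescope to minus the potential at the start; a bias there cancels it, and
without a bias the start is an input, where `c` vanishes. -/
theorem biasLabel_add_edgeSum_potentialLabel {c : V → ℝ} (hin : ∀ v, G.IsInput v → c v = 0)
    (hout : ∀ v, G.IsOutput v → c v = 0) (p : G.Path) :
    G.biasLabel (G.potentialLabel c) (p.verts.head p.ne_nil)
      + G.edgeSum (G.potentialLabel c) p.verts = 0 := by
  obtain ⟨l, hne, hchain, hstart, hfin⟩ := p
  cases l with
  | nil => exact absurd rfl hne
  | cons v l =>
    simp only [List.head_cons] at hstart ⊢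
    rw [edgeSum_potentialLabel c v l hchain, hout _ hfin, biasLabel]
    split_ifs with hv
    · simp [potentialLabel]
    · rw [hin v (hstart.resolve_right hv)]
      simp

/-- Labels that sum to zero along every path derive from a potential vanishing at the input and
output neurons. -/
theorem exists_potential [Finite V] {x : EuclideanSpace ℝ G.Param}
    (hx : ∀ p : G.Path, G.biasLabel x (p.verts.head p.ne_nil) + G.edgeSum x p.verts = 0) :
    ∃ c : V → ℝ, (∀ v, G.IsInput v → c v = 0) ∧ (∀ v, G.IsOutput v → c v = 0) ∧
      x = G.potentialLabel c := by
  -- The potential is minus the label sum from `v` to an output. It is independent of the chain: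
  -- prepending an edge `u → v` reduces to `u`, and at an input the hypothesis gives sum `0`.
  have key : ∀ v, ∃ c : ℝ, ∀ l : List V, (v :: l).IsChain G.graph.Adj →
      G.IsOutput ((v :: l).getLast (List.cons_ne_nil v l)) → G.edgeSum x (v :: l) = -c := by
    intro v
    induction v using wellFounded_adj (G := G).induction with
    | _ v ih =>
      by_cases hv : G.IsInput v
      · refine ⟨0, fun l hl hlast => ?_⟩
        have := hx ⟨v :: l, List.cons_ne_nil v l, hl, Or.inl hv, hlast⟩
        have hb : v ∉ G.biased := fun h => by
          obtain ⟨u, hu⟩ := G.biased_not_input v h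
          exact hv u hu
        simpa [biasLabel, hb] using this
      · simp only [IsInput, not_forall, not_not] at hv
        obtain ⟨u, hu⟩ := hv
        obtain ⟨c, hc⟩ := ih u hu
        refine ⟨c + G.weight x u v, fun l hl hlast => ?_⟩
        have := hc (v :: l) (List.isChain_cons_cons.mpr ⟨hu, hl⟩)
          (by rwa [List.getLast_cons (List.cons_ne_nil v l)])
        rw [edgeSum] at this
        linarith
  choose c hc using key
  refine ⟨c, fun v hv => ?_, fun v hv => ?_, ?_⟩
  · obtain ⟨l, hl, hlast⟩ := exists_chain_to_output (G := G) v
    have h1 := hc v l hl hlast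
    have h2 : G.biasLabel x v + G.edgeSum x (v :: l) = 0 :=
      hx ⟨v :: l, List.cons_ne_nil v l, hl, Or.inl hv, hlast⟩
    have hb : v ∉ G.biased := fun h => by
      obtain ⟨u, hu⟩ := G.biased_not_input v h
      exact hv u hu
    rw [biasLabel, dif_neg hb] at h2
    linarith
  · have := hc v [] (List.isChain_singleton v) hv
    simp only [edgeSum] at this
    linarith
  · ext i
    rcases i with ⟨⟨u, v⟩, huv⟩ | ⟨v, hv⟩
    · obtain ⟨l, hl, hlast⟩ := exists_chain_to_output (G := G) v
      have h1 := hc v l hl hlast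
      have h2 := hc u (v :: l) (List.isChain_cons_cons.mpr ⟨huv, hl⟩)
        (by rwa [List.getLast_cons (List.cons_ne_nil v l)])
      rw [edgeSum, weight, dif_pos huv] at h2
      simp only [potentialLabel]
      linarith
    · obtain ⟨l, hl, hlast⟩ := exists_chain_to_output (G := G) v
      have h1 := hc v l hl hlast
      have h2 : G.biasLabel x v + G.edgeSum x (v :: l) = 0 :=
      hx ⟨v :: l, List.cons_ne_nil v l, hl, Or.inr hv, hlast⟩
      rw [biasLabel, dif_pos hv] at h2
      simp only [potentialLabel]
      linarith

/-! ### Differentiating the path-lifting -/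

variable (G) in
theorem contDiff_pathLifting [Finite V] {n : WithTop ℕ∞} : ContDiff ℝ n G.pathLifting := by
  have hcoord : ∀ i, ContDiff ℝ n fun θ : EuclideanSpace ℝ G.Param => θ i := fun i =>
    (EuclideanSpace.proj i : EuclideanSpace ℝ G.Param →L[ℝ] ℝ).contDiff
  have hw : ∀ u v, ContDiff ℝ n fun θ : EuclideanSpace ℝ G.Param => G.weight θ u v := by
    intro u v
    unfold weight
    split_ifs
    exacts [hcoord _, contDiff_const]
  have hs : ∀ v, ContDiff ℝ n fun θ : EuclideanSpace ℝ G.Param => G.startFactor θ v := by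
    intro v
    unfold startFactor
    split_ifs
    exacts [hcoord _, contDiff_const]
  have hp : ∀ l, ContDiff ℝ n fun θ : EuclideanSpace ℝ G.Param => G.weightProd θ l := by
    intro l
    induction l with
    | nil => exact contDiff_const
    | cons u l ih =>
      cases l with
      | nil => exact contDiff_const
      | cons v l => exact (hw u v).mul ih
  exact contDiff_euclidean.mpr fun p => (hs _).mul (hp _)

/-- The derivative of the path-lifting in the direction of an infinitesimal rescaling. -/
theorem fderiv_pathLifting_rescale [Finite V] (x θ : EuclideanSpace ℝ G.Param) (p : G.Path) :
    fderiv ℝ G.pathLifting θ (G.rescale x θ) p = G.pathLifting θ p *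
      (G.biasLabel x (p.verts.head p.ne_nil) + G.edgeSum x p.verts) := by
  -- Each factor has derivative itself times its label, so by the product rule labels add up along a
  -- path.
  have hcoord : ∀ i, HasDerivAt (fun t : ℝ => (θ + t • G.rescale x θ) i) (x i * θ i) 0 := by
    intro i
    simpa [rescale] using ((hasDerivAt_id (0 : ℝ)).mul_const (x i * θ i)).const_add (θ i)
  have hw : ∀ u v, HasDerivAt (fun t : ℝ => G.weight (θ + t • G.rescale x θ) u v)
      (G.weight θ u v * G.weight x u v) 0 := by
    intro u v
    unfold weight
    split_ifs
    · rw [mul_comm]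
      exact hcoord _
    · simpa using hasDerivAt_const (0 : ℝ) (0 : ℝ)
  have hs : ∀ v, HasDerivAt (fun t : ℝ => G.startFactor (θ + t • G.rescale x θ) v)
      (G.startFactor θ v * G.biasLabel x v) 0 := by
    intro v
    unfold startFactor biasLabel
    split_ifs
    · rw [mul_comm]
      exact hcoord _
    · simpa using hasDerivAt_const (0 : ℝ) (1 : ℝ)
  have hp : ∀ l, HasDerivAt (fun t : ℝ => G.weightProd (θ + t • G.rescale x θ) l)
      (G.weightProd θ l * G.edgeSum x l) 0 := by
    intro l
    induction l with
    | nil => simpa [weightProd, edgeSum] using hasDerivAt_const (0 : ℝ) (1 : ℝ)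
    | cons u l ih =>
      cases l with
      | nil => simpa [weightProd, edgeSum] using hasDerivAt_const (0 : ℝ) (1 : ℝ)
      | cons v l =>
        simp only [weightProd, edgeSum]
        refine ((hw u v).fun_mul ih).congr_deriv ?_
        rw [zero_smul, add_zero]
        ring
  have h1 : HasDerivAt (fun t : ℝ => G.pathLifting (θ + t • G.rescale x θ) p)
      (G.pathLifting θ p *
        (G.biasLabel x (p.verts.head p.ne_nil) + G.edgeSum x p.verts)) 0 := by
    simp only [pathLifting]
    refine ((hs (p.verts.head p.ne_nil)).fun_mul (hp p.verts)).congr_deriv ?_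
    rw [zero_smul, add_zero]
    ring
  have h2 : HasDerivAt (fun t : ℝ => G.pathLifting (θ + t • G.rescale x θ) p)
      (fderiv ℝ G.pathLifting θ (G.rescale x θ) p) 0 := by
    have hline : HasDerivAt (fun t : ℝ => θ + t • G.rescale x θ) (G.rescale x θ) 0 := by
      simpa using ((hasDerivAt_id (0 : ℝ)).smul_const (G.rescale x θ)).const_add θ
    have hd : HasFDerivAt G.pathLifting (fderiv ℝ G.pathLifting θ)
        (θ + (0 : ℝ) • G.rescale x θ) := by
      rw [zero_smul, add_zero]
      exact ((contDiff_pathLifting G (n := 1)).differentiable one_ne_zero θ).hasFDerivAt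
    exact (EuclideanSpace.proj p : EuclideanSpace ℝ G.Path →L[ℝ] ℝ).hasFDerivAt.comp_hasDerivAt
      0 (hd.comp_hasDerivAt 0 hline)
  exact h2.unique h1

/-! ### Balancedness laws and the kernel of the derivative -/

/-- The balancedness quantity attached to a potential. -/
def balance [Finite V] (c : V → ℝ) (θ : EuclideanSpace ℝ G.Param) : ℝ :=
  ∑ i, G.potentialLabel c i * θ i ^ 2

theorem gradient_balance [Finite V] (c : V → ℝ) (θ : EuclideanSpace ℝ G.Param) :
    gradient (G.balance c) θ = (2 : ℝ) • G.rescale (G.potentialLabel c) θ :=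
  (hasGradientAt_sum_mul_sq (fun i => G.potentialLabel c i) θ).gradient

theorem contDiff_balance [Finite V] (c : V → ℝ) : ContDiff ℝ 1 (balance (G := G) c) :=
  ContDiff.sum fun i _ => contDiff_const.mul
    ((EuclideanSpace.proj i : EuclideanSpace ℝ G.Param →L[ℝ] ℝ).contDiff.pow 2)

theorem isConservationLaw_balance [Finite V] {c : V → ℝ} (hin : ∀ v, G.IsInput v → c v = 0)
    (hout : ∀ v, G.IsOutput v → c v = 0) :
    IsConservationLaw G.pathLifting univ (balance (G := G) c) := by
  refine ⟨(contDiff_balance c).contDiffOn, fun θ _ => ?_⟩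
  rw [gradient_balance, map_smul]
  ext p
  rw [PiLp.smul_apply, fderiv_pathLifting_rescale,
    biasLabel_add_edgeSum_potentialLabel hin hout]
  simp

theorem fderiv_balance_apply [Finite V] (c : V → ℝ) (θ δ : EuclideanSpace ℝ G.Param) :
    fderiv ℝ (balance c) θ δ = 2 * ∑ i, G.potentialLabel c i * (θ i * δ i) := by
  rw [← inner_gradient_apply, gradient_balance, inner_smul_left, PiLp.inner_apply]
  simp only [conj_trivial, rescale]
  congr 1
  refine Finset.sum_congr rfl fun i _ => ?_
  simp
  ring

theorem pathLifting_ne_zero [Finite V] {θ : EuclideanSpace ℝ G.Param} (hθ : ∀ i, θ i ≠ 0)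
    (p : G.Path) : G.pathLifting θ p ≠ 0 := by
  refine mul_ne_zero ?_ ?_
  · unfold startFactor
    split_ifs
    exacts [hθ _, one_ne_zero]
  · have hp : ∀ l : List V, l.IsChain G.graph.Adj → G.weightProd θ l ≠ 0 := by
      intro l hl
      induction l with
      | nil => exact one_ne_zero
      | cons u l ih =>
        cases l with
        | nil => exact one_ne_zero
        | cons v l =>
          obtain ⟨hu, hl⟩ := List.isChain_cons_cons.mp hl
          refine mul_ne_zero ?_ (ih hl)
          rw [weight, dif_pos hu]
          exact hθ _
    exact hp _ p.chain

/-- The derivative of the path-lifting is injective on the common kernel of the differentials of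
the balancedness quantities. -/
theorem eq_zero_of_fderiv_eq_zero [Finite V] {θ δ : EuclideanSpace ℝ G.Param}
    (hθ : ∀ i, θ i ≠ 0) (hφ : fderiv ℝ G.pathLifting θ δ = 0)
    (hbal : ∀ c : V → ℝ, (∀ v, G.IsInput v → c v = 0) → (∀ v, G.IsOutput v → c v = 0) →
      fderiv ℝ (balance c) θ δ = 0) : δ = 0 := by
  set x : EuclideanSpace ℝ G.Param := WithLp.toLp 2 fun i => δ i / θ i with hx
  have hδ : G.rescale x θ = δ := by
    ext i
    simp only [rescale, hx]
    exact div_mul_cancel₀ _ (hθ i)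
  obtain ⟨c, hin, hout, hc⟩ := exists_potential (x := x) fun p => by
    have := fderiv_pathLifting_rescale x θ p
    rw [hδ, hφ] at this
    exact (mul_eq_zero.mp this.symm).resolve_left (pathLifting_ne_zero hθ p)
  -- Testing against the potential produced by `δ` itself turns the differential into twice the
  -- squared norm of `δ`.
  have h0 := hbal c hin hout
  rw [fderiv_balance_apply, ← hc] at h0
  have h1 : ∑ i, δ i ^ 2 = 0 := by
    rw [← (mul_eq_zero.mp h0).resolve_left two_ne_zero]
    refine Finset.sum_congr rfl fun i _ => ?_
    have := hθ i
    simp only [hx]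
    field_simp
  rw [Finset.sum_eq_zero_iff_of_nonneg fun i _ => sq_nonneg _] at h1
  ext i
  simpa using h1 i (Finset.mem_univ i)

/-! ### Reduction to finitely many laws -/

variable (G) in
open Classical in
/-- The indicator function of the neuron `v`, replaced by `0` if `v` is an input or output. -/
def hiddenIndicator (v w : V) : ℝ :=
  if w = v ∧ ¬ G.IsInput v ∧ ¬ G.IsOutput v then 1 else 0

theorem hiddenIndicator_of_isInput (v : V) {w : V} (hw : G.IsInput w) :
    G.hiddenIndicator v w = 0 :=
  if_neg fun h => h.2.1 (h.1 ▸ hw)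

theorem hiddenIndicator_of_isOutput (v : V) {w : V} (hw : G.IsOutput w) :
    G.hiddenIndicator v w = 0 :=
  if_neg fun h => h.2.2 (h.1 ▸ hw)

theorem sum_mul_hiddenIndicator [Fintype V] {c : V → ℝ} (hin : ∀ v, G.IsInput v → c v = 0)
    (hout : ∀ v, G.IsOutput v → c v = 0) (w : V) :
    ∑ v, c v * G.hiddenIndicator v w = c w := by
  rw [Finset.sum_eq_single w]
  · by_cases h : G.IsInput w
    · rw [hin w h, zero_mul]
    by_cases h' : G.IsOutput w
    · rw [hout w h', zero_mul]
    · rw [hiddenIndicator, if_pos ⟨rfl, h, h'⟩, mul_one]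
  · intro v _ hv
    rw [hiddenIndicator, if_neg fun h => hv h.1.symm, mul_zero]
  · exact fun h => absurd (Finset.mem_univ w) h

/-- The differentials of the balancedness quantities of the hidden neurons span those of all
potentials vanishing at the inputs and outputs. -/
theorem fderiv_balance_eq_sum [Fintype V] {c : V → ℝ} (hin : ∀ v, G.IsInput v → c v = 0)
    (hout : ∀ v, G.IsOutput v → c v = 0) (θ δ : EuclideanSpace ℝ G.Param) :
    fderiv ℝ (balance c) θ δ = ∑ v, c v * fderiv ℝ (balance (G.hiddenIndicator v)) θ δ := by
  have hlabel : ∀ i, G.potentialLabel c i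
      = ∑ v, c v * G.potentialLabel (G.hiddenIndicator v) i := by
    rintro (⟨⟨u, w⟩, h⟩ | ⟨w, h⟩)
    · simp only [potentialLabel, mul_sub, Finset.sum_sub_distrib,
        sum_mul_hiddenIndicator hin hout]
    · simp only [potentialLabel, sum_mul_hiddenIndicator hin hout]
  simp only [fderiv_balance_apply, hlabel, Finset.sum_mul, Finset.mul_sum]
  rw [Finset.sum_comm]
  refine Finset.sum_congr rfl fun v _ => Finset.sum_congr rfl fun i _ => ?_
  ring

end DAGNetwork

end IntrinsicFlow

end

open IntrinsicFlow IntrinsicFlow.DAGNetwork in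
theorem mainTheorem1 {V : Type*} [Finite V] (G : IntrinsicFlow.DAGNetwork V) :
    ∃ Θ : Set (EuclideanSpace ℝ G.Param), IsOpen Θ ∧ Dense Θ ∧
      ∀ θ₀ ∈ Θ, ∃ U : Set (EuclideanSpace ℝ G.Param), IsOpen U ∧ θ₀ ∈ U ∧ U ⊆ Θ ∧
        IntrinsicFlow.IntrinsicRecoverability G.pathLifting U θ₀ ∧
        IntrinsicFlow.IntrinsicMetric G.pathLifting U θ₀ ∧
        IntrinsicFlow.IntrinsicDynamic G.pathLifting U θ₀ := by
  refine ⟨{θ | ∀ i, θ i ≠ 0}, isOpen_forall_ne_zero, dense_forall_ne_zero, fun θ₀ hθ₀ => ?_⟩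
  -- One law per neuron keeps the indexing simple; those of inputs and outputs are identically zero.
  let e := Finite.equivFin V
  let h : EuclideanSpace ℝ G.Param → EuclideanSpace ℝ (Fin (Nat.card V)) := fun θ =>
    WithLp.toLp 2 fun j => G.balance (G.hiddenIndicator (e.symm j)) θ
  have hlaw : AreConservationLaws G.pathLifting h := fun j =>
    isConservationLaw_balance (fun _ => hiddenIndicator_of_isInput _)
      (fun _ => hiddenIndicator_of_isOutput _)
  refine exists_intrinsic_of_immersion (contDiff_pathLifting G) hlaw (fun δ hφ hh => ?_)
    isOpen_forall_ne_zero hθ₀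
  have hcomp : ∀ v, fderiv ℝ (balance (G.hiddenIndicator v)) θ₀ δ = 0 := by
    intro v
    have hd : Differentiable ℝ h :=
      (contDiff_euclidean.mpr fun j => contDiff_balance _).differentiable one_ne_zero
    have h1 := ((EuclideanSpace.proj (e v) :
      EuclideanSpace ℝ (Fin (Nat.card V)) →L[ℝ] ℝ).hasFDerivAt.comp θ₀ (hd θ₀).hasFDerivAt).fderiv
    have h2 : (EuclideanSpace.proj (e v) : EuclideanSpace ℝ (Fin (Nat.card V)) →L[ℝ] ℝ) ∘ h
        = balance (G.hiddenIndicator v) := by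
      ext θ
      simp [h]
    rw [← h2, h1, ContinuousLinearMap.comp_apply, hh, map_zero]
  have := Fintype.ofFinite V
  refine eq_zero_of_fderiv_eq_zero hθ₀ hφ fun c hin hout => ?_
  rw [fderiv_balance_eq_sum hin hout]
  exact Finset.sum_eq_zero fun v _ => by rw [hcomp v, mul_zero]
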